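/- **Nonlinear pressure and the dual Kantorovich problem.** Conventions. For a real normed space $X$, $X^*$ is its topological dual with the weak$^*$ topology and the corresponding Borel $\sigma$-algebra, and $\|\cdot\|$ denotes also the operator norm on $X^*$. For $g:X\to\mathbb R$ put $g^*(y)=\sup_{x\in X}\{y(x)-g(x)\}\in(-\infty,\infty]$ and $\mathrm{dom}(g^*)=\{g^*<\infty\}$. We say that $g^*$ has minimal linear growth $\lambda$ if $\lim_{R\to\infty}\sup_{\|y\|>R}\{\lambda\|y\|-g^*(y)\}=-\infty$. Assume the following. * (B1) $X_\pm$ are real normed spaces, $K$ is a compact convex subset of a Hausdorff real topological vector space $E$, $\tau_\pm:K\to X_\pm$ are continuous and affine, and $f:K\to\mathbb R\cup\{-\infty\}$ is upper semicontinuous, concave and not identically $-\infty$. Put $\|\tau_\pm\|_\infty=\sup_{\mu\in K}\|\tau_\pm(\mu)\|$. * (B2) $g_-:X_-\to\mathbb R$ is convex and lower semicontinuous; there is $R_0>0$ such that $\{y\in\mathrm{dom}(g_-^*):\|y\|\le R\}$ is nonempty and weak$^*$-closed for all $R\ge R_0$; and $g_-^*$ has minimal linear growth $\|\tau_-\|_\infty$.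 * (B3) $g_+:X_+\to\mathbb R$ is convex and lower semicontinuous, $\mathrm{dom}(g_+^*)=X_+^*$, and $g_+^*$ has minimal linear growth $\|\tau_+\|_\infty$. Suppose in addition that $X_\pm$ are separable, that $g_\pm$ are Gateaux differentiable with gradients $\nabla g_\pm:X_\pm\to X_\pm^*$, that $g_\pm^*$ are real-valued and continuous on $X_\pm^*$, and that $g_-^*$ is strictly convex. Let $F=f-g_-\circ\tau_-+g_+\circ\tau_+:K\to\mathbb R\cup\{-\infty\}$. Let $E_F$ be the set of all $\mu\in K$ that are limits of nets $(\mu_j)$ in $K$ with $\lim_j F(\mu_j)=\sup F(K)$, and let $G_F$ be the closed convex hull of $E_F$. Let $\mu\in G_F$, let $\mathfrak m$ be any Borel probability measure carried by $E_F$ with barycenter $\mu$ (i.e. $\varphi(\mu)=\int\varphi\,d\mathfrak m$ for every continuous linear functional $\varphi$ on $E$), and let the order-parameter distributions $\mathfrak y_\pm$ be the pushforwards of $\mathfrak m$ under $\nabla g_\pm\circ\tau_\pm$. For $y_\pm\in X_\pm^*$ put $$P_{\rm NL}(y_+,y_-)=\sup_{\nu\in K}\{f(\nu)-y_-(\tau_-(\nu))+y_+(\tau_+(\nu))\}+g_-^*(y_-)-g_+^*(y_+).$$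 Then $\sup F(K)\in\mathbb R$ and $$\sup F(K)=\sup\Big\{\int_{X_+^*}P^+\,d\mathfrak y_+-\int_{X_-^*}P^-\,d\mathfrak y_-\Big\},$$ where the supremum is over all pairs of continuous functions $P^\pm:X_\pm^*\to\mathbb R$ such that $P^+(y_+)-P^-(y_-)\le P_{\rm NL}(y_+,y_-)$ for all $y_\pm\in X_\pm^*$. This holds for each of the two usual readings of "continuous" on $X_\pm^*$, used both for $g_\pm^*$ and for $P^\pm$: weak$^*$-continuous, or continuous for the operator norm. In the norm reading, $P^\pm$ are in addition required to be $\mathfrak y_\pm$-integrable, because norm-continuous functions need not be weak$^*$-Borel. -/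

import Mathlib

open Set Filter Topology MeasureTheory

noncomputable section

namespace Bogoliubov

/-! ### The dual space, the Legendre-Fenchel transform and Gateaux derivatives

The topological dual `X*` of a real normed space `X` is the type `WeakDual ℝ X`, that is, the
continuous linear functionals on `X` endowed with the weak* topology (and with the Borel
σ-algebra of that topology). -/

section Dual

variable {X : Type*} [NormedAddCommGroup X] [NormedSpace ℝ X]

instance instMeasurableSpaceWeakDual : MeasurableSpace (WeakDual ℝ X) := borel _

instance instBorelSpaceWeakDual : BorelSpace (WeakDual ℝ X) := ⟨rfl⟩

/-- The operator norm of a continuous linear functional. -/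
def opNorm (y : WeakDual ℝ X) : ℝ := ‖WeakDual.toStrongDual y‖

/-- Continuity of a function on `X*` with respect to the topology of the operator norm. (Plain
`Continuous` is continuity with respect to the weak* topology.) -/
def NormContinuous {Y : Type*} [TopologicalSpace Y] (P : WeakDual ℝ X → Y) : Prop :=
  Continuous fun y : StrongDual ℝ X => P (StrongDual.toWeakDual y)

/-- The Legendre-Fenchel transform `g*(y) = sup_x { y(x) - g(x) }`. -/
def conj (g : X → ℝ) (y : WeakDual ℝ X) : EReal := ⨆ x : X, ((y x - g x : ℝ) : EReal)

/-- `g*` has minimal linear growth `c`: the supremum of `c ‖y‖ - g*(y)` over all `y` outside the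
closed ball of radius `R` tends to `-∞` as `R → ∞`. -/
def MinimalLinearGrowth (g : X → ℝ) (c : ℝ) : Prop :=
  Tendsto
    (fun R : ℝ => ⨆ y : WeakDual ℝ X, ⨆ _ : R < opNorm y, ((c * opNorm y : ℝ) : EReal) - conj g y)
    atTop (𝓝 ⊥)

/-- `g` is Gateaux differentiable: at each point the directional derivatives exist in all
directions and form a continuous linear functional of the direction. -/
def GateauxDifferentiable (g : X → ℝ) : Prop :=
  ∀ x : X, ∃ y : WeakDual ℝ X, ∀ v : X, HasLineDerivAt ℝ g (y v) x v

/-- The gradient mapping `∇g : X → X*` of a Gateaux differentiable function. -/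
def gradient {g : X → ℝ} (hg : GateauxDifferentiable g) (x : X) : WeakDual ℝ X :=
  (hg x).choose

end Dual

/-! ### The standing conditions -/

section Conditions

variable {E : Type*} [AddCommGroup E] [Module ℝ E] [TopologicalSpace E]
variable {X : Type*} [NormedAddCommGroup X] [NormedSpace ℝ X]
variable {Xp : Type*} [NormedAddCommGroup Xp] [NormedSpace ℝ Xp]
variable {Xm : Type*} [NormedAddCommGroup Xm] [NormedSpace ℝ Xm]

/-- `τ` restricted to the convex set `K` is affine. -/
def IsAffineOn (K : Set E) (τ : E → X) : Prop :=
  ∀ x ∈ K, ∀ y ∈ K, ∀ a b : ℝ, 0 ≤ a → 0 ≤ b → a + b = 1 →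
    τ (a • x + b • y) = a • τ x + b • τ y

/-- The restriction of `f` to the convex set `K` is concave, for `f` with values in
`{-∞} ∪ ℝ` on `K`. -/
def IsConcaveOn (K : Set E) (f : E → EReal) : Prop :=
  ∀ x ∈ K, ∀ y ∈ K, ∀ a b : ℝ, 0 ≤ a → 0 ≤ b → a + b = 1 →
    (a : EReal) * f x + (b : EReal) * f y ≤ f (a • x + b • y)

/-- The uniform norm `‖τ‖_∞ = sup { ‖τ(μ)‖ : μ ∈ K }`. -/
def supNorm (K : Set E) (τ : E → X) : ℝ := sSup ((fun μ => ‖τ μ‖) '' K)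

/-- Condition B1: `K` is compact and convex, `τ₊` and `τ₋` are continuous and affine on `K`, and
`f : K → {-∞} ∪ ℝ` is upper semicontinuous, concave and not identically `-∞`. -/
structure ConditionB1 (K : Set E) (f : E → EReal) (τp : E → Xp) (τm : E → Xm) : Prop where
  isCompact : IsCompact K
  convex : Convex ℝ K
  continuousOn_τp : ContinuousOn τp K
  continuousOn_τm : ContinuousOn τm K
  affine_τp : IsAffineOn K τp
  affine_τm : IsAffineOn K τm
  ne_top : ∀ μ ∈ K, f μ ≠ ⊤
  upperSemicontinuousOn : UpperSemicontinuousOn f K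
  concave : IsConcaveOn K f
  exists_ne_bot : ∃ μ ∈ K, f μ ≠ ⊥

/-- Condition B2 on `g₋`. -/
structure ConditionB2 (K : Set E) (τm : E → Xm) (gm : Xm → ℝ) : Prop where
  lowerSemicontinuous : LowerSemicontinuous gm
  convex : ConvexOn ℝ univ gm
  closed : ∃ R₀ : ℝ, 0 < R₀ ∧ ∀ R : ℝ, R₀ ≤ R →
    ({y : WeakDual ℝ Xm | opNorm y ≤ R} ∩ {y | conj gm y ≠ ⊤}).Nonempty ∧
    IsClosed ({y : WeakDual ℝ Xm | opNorm y ≤ R} ∩ {y | conj gm y ≠ ⊤})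
  growth : MinimalLinearGrowth gm (supNorm K τm)

/-- Condition B3 on `g₊`. Boundedness of `g₊` on bounded sets is not asked for: it would only be
needed on the ball of radius `‖τ₊‖_∞`, where the growth of `g₊*` yields it. -/
structure ConditionB3 (K : Set E) (τp : E → Xp) (gp : Xp → ℝ) : Prop where
  lowerSemicontinuous : LowerSemicontinuous gp
  convex : ConvexOn ℝ univ gp
  full_domain : ∀ y : WeakDual ℝ Xp, conj gp y ≠ ⊤
  growth : MinimalLinearGrowth gp (supNorm K τp)

end Conditions

/-! ### The nonlinear pressure, equilibrium states and approximating pressures -/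

section Pressure

variable {E : Type*}
variable {X : Type*} [NormedAddCommGroup X] [NormedSpace ℝ X]
variable {Xp : Type*} [NormedAddCommGroup Xp] [NormedSpace ℝ Xp]
variable {Xm : Type*} [NormedAddCommGroup Xm] [NormedSpace ℝ Xm]

/-- The function `F = f - g₋ ∘ τ₋ + g₊ ∘ τ₊`. -/
def nonlinearF (f : E → EReal) (τp : E → Xp) (τm : E → Xm) (gp : Xp → ℝ) (gm : Xm → ℝ)
    (μ : E) : EReal :=
  f μ + ((gp (τp μ) - gm (τm μ) : ℝ) : EReal)

/-- The nonlinear pressure `sup F(K)`. -/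
def nonlinearPressure (K : Set E) (f : E → EReal) (τp : E → Xp) (τm : E → Xm)
    (gp : Xp → ℝ) (gm : Xm → ℝ) : EReal :=
  ⨆ μ ∈ K, nonlinearF f τp τm gp gm μ

/-- The linear approximating pressure `P_L(y₊, y₋) = sup_K { f - y₋ ∘ τ₋ + y₊ ∘ τ₊ }`. -/
def PL (K : Set E) (f : E → EReal) (τp : E → Xp) (τm : E → Xm)
    (yp : WeakDual ℝ Xp) (ym : WeakDual ℝ Xm) : EReal :=
  ⨆ μ ∈ K, f μ + ((yp (τp μ) - ym (τm μ) : ℝ) : EReal)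

/-- The nonlinear approximating pressure `P_NL(y₊, y₋) = P_L(y₊, y₋) + g₋*(y₋) - g₊*(y₊)`. -/
def PNL (K : Set E) (f : E → EReal) (τp : E → Xp) (τm : E → Xm) (gp : Xp → ℝ) (gm : Xm → ℝ)
    (yp : WeakDual ℝ Xp) (ym : WeakDual ℝ Xm) : EReal :=
  PL K f τp τm yp ym + conj gm ym - conj gp yp

variable [TopologicalSpace E]

/-- The set `E_F` of nonlinear equilibrium states: limits in `K` of nets in `K` along which `F`
converges to `sup F(K)` (nets are expressed by filters). -/
def equilibriumStates (K : Set E) (f : E → EReal) (τp : E → Xp) (τm : E → Xm)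
    (gp : Xp → ℝ) (gm : Xm → ℝ) : Set E :=
  {μ | μ ∈ K ∧ ∃ l : Filter E, l.NeBot ∧ l ≤ 𝓟 K ∧ l ≤ 𝓝 μ ∧
    Tendsto (nonlinearF f τp τm gp gm) l (𝓝 (nonlinearPressure K f τp τm gp gm))}

/-- The set `G_F` of generalized nonlinear equilibrium states: the closed convex hull of `E_F`. -/
def generalizedEquilibriumStates [AddCommGroup E] [Module ℝ E] (K : Set E) (f : E → EReal)
    (τp : E → Xp) (τm : E → Xm) (gp : Xp → ℝ) (gm : Xm → ℝ) : Set E :=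
  closedConvexHull ℝ (equilibriumStates K f τp τm gp gm)

/-- `μ` is a barycenter of the measure `m`. -/
def IsBarycenter [AddCommGroup E] [Module ℝ E] [MeasurableSpace E] (m : Measure E) (μ : E) :
    Prop :=
  ∀ φ : E →L[ℝ] ℝ, φ μ = ∫ x, φ x ∂m

/-- The probability measure `m` represents `μ`: it is carried by `E_F` and has barycenter `μ`. -/
structure Represents [AddCommGroup E] [Module ℝ E] [MeasurableSpace E] (K : Set E)
    (f : E → EReal) (τp : E → Xp) (τm : E → Xm) (gp : Xp → ℝ) (gm : Xm → ℝ)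
    (m : Measure E) (μ : E) : Prop where
  isProbabilityMeasure : IsProbabilityMeasure m
  carried : m (equilibriumStates K f τp τm gp gm)ᶜ = 0
  barycenter : IsBarycenter m μ

/-- The order-parameter distribution: the pushforward of `m` through `∇g ∘ τ`. -/
def orderParameterLaw [MeasurableSpace E] (m : Measure E) (τ : E → X) {g : X → ℝ}
    (hg : GateauxDifferentiable g) : Measure (WeakDual ℝ X) :=
  m.map fun ν => gradient hg (τ ν)

/-! ### The dual Kantorovich problem -/

/-- The constraint `P₊(y₊) - P₋(y₋) ≤ c(y₊, y₋)` for all `y₊`, `y₋`. -/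
def DualFeasible (c : WeakDual ℝ Xp → WeakDual ℝ Xm → EReal)
    (Pp : WeakDual ℝ Xp → ℝ) (Pm : WeakDual ℝ Xm → ℝ) : Prop :=
  ∀ yp ym, ((Pp yp - Pm ym : ℝ) : EReal) ≤ c yp ym

/-- The values of the dual problem at all feasible pairs of weak* continuous functions. -/
def weakStarDualValues (c : WeakDual ℝ Xp → WeakDual ℝ Xm → EReal)
    (lp : Measure (WeakDual ℝ Xp)) (lm : Measure (WeakDual ℝ Xm)) : Set ℝ :=
  {r | ∃ (Pp : WeakDual ℝ Xp → ℝ) (Pm : WeakDual ℝ Xm → ℝ), Continuous Pp ∧ Continuous Pm ∧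
    DualFeasible c Pp Pm ∧ r = (∫ y, Pp y ∂lp) - ∫ y, Pm y ∂lm}

/-- The values of the dual problem at all feasible pairs of norm continuous functions. As norm
continuous functions need not be Borel for the weak* topology, integrability is required. -/
def normDualValues (c : WeakDual ℝ Xp → WeakDual ℝ Xm → EReal)
    (lp : Measure (WeakDual ℝ Xp)) (lm : Measure (WeakDual ℝ Xm)) : Set ℝ :=
  {r | ∃ (Pp : WeakDual ℝ Xp → ℝ) (Pm : WeakDual ℝ Xm → ℝ),
    NormContinuous Pp ∧ NormContinuous Pm ∧ Integrable Pp lp ∧ Integrable Pm lm ∧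
    DualFeasible c Pp Pm ∧ r = (∫ y, Pp y ∂lp) - ∫ y, Pm y ∂lm}

end Pressure

end Bogoliubov

end

/-!
The dual problem has an explicit solution, so no general duality theorem for optimal transport and
no minimax theorem is involved.

*Equilibrium states.* For `y = ∇g(x)` one has `g*(y) = y(x) - g(x)`, so the minimal linear growth of
`g*` bounds the gradients of `g` uniformly on the ball of radius `‖τ‖_∞`
(`exists_opNorm_gradient_le`). Hence `g` is Lipschitz there, and by weak* compactness of balls `∇g`
is norm-to-weak* continuous there (`continuousOn_gradient`). Consequently `F` is upper
semicontinuous on `K`, `sup F(K)` is finite, and `E_F` is the compact set of maximizers of `F`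
(`equilibriumStates_eq`).

*Weak duality.* Let `ν` be a maximizer of `F` and `y± = ∇g±(τ± ν)`. First-order optimality along
segments in `K` shows that `ν` maximizes `f - y₋ ∘ τ₋ + y₊ ∘ τ₊` (`linearized_le_of_isMaxOn`), so
`P_NL(y₊, y₋) ≤ F ν = sup F(K)` (`PNL_gradient_le`). Integrating the constraint over `ν` bounds
every value of the dual problem by `sup F(K)` (`integral_sub_integral_le`).

*Attainment.* The pair `P⁺(y₊) = sup_K { f - g₋ ∘ τ₋ + y₊ ∘ τ₊ } - g₊*(y₊)`, `P⁻ = 0` is feasible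
because `-g₋(τ₋ μ) ≤ g₋*(y₋) - y₋(τ₋ μ)` (`dualFeasible_potential`), and `P⁺ = sup F(K)` at the
order parameters of equilibrium states (`potential_gradient_eq`). So the supremum is a maximum.

*Continuity of `P⁺`.* The first term is Lipschitz for the norm, which settles the norm reading. In
the weak* reading, a real-valued weak* continuous `g₊*` is bounded on a subspace of finite
codimension; being coercive, it forces `X₊*` to be finite-dimensional
(`finiteDimensional_of_continuous_conj`), where the weak* and norm topologies agree.
-/

noncomputable section

namespace Bogoliubov

/-! ### Gateaux gradients of convex functions -/

section Gradient

variable {X : Type*} [NormedAddCommGroup X] [NormedSpace ℝ X] {g : X → ℝ}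

theorem gradient_hasLineDerivAt (hg : GateauxDifferentiable g) (x v : X) :
    HasLineDerivAt ℝ g (gradient hg x v) x v :=
  (hg x).choose_spec v

theorem gradient_subgradient (hg : GateauxDifferentiable g) (hc : ConvexOn ℝ univ g) (x z : X) :
    g x + gradient hg x (z - x) ≤ g z := by
  have hconv : ConvexOn ℝ univ fun t : ℝ => g (x + t • (z - x)) := by
    have := hc.comp_affineMap (AffineMap.lineMap (k := ℝ) x z)
    simpa [Function.comp_def, AffineMap.lineMap_apply, add_comm] using this
  have h := hconv.le_slope_of_hasDerivAt (mem_univ 0) (mem_univ 1) one_pos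
    (gradient_hasLineDerivAt hg x (z - x))
  simp [slope_def_field] at h
  rw [map_sub]
  linarith

theorem eq_gradient_of_subgradient (hg : GateauxDifferentiable g) {x : X} {y : WeakDual ℝ X}
    (hy : ∀ z, g x + y (z - x) ≤ g z) : y = gradient hg x := by
  refine DFunLike.ext _ _ fun v => ?_
  have hd : HasDerivAt (fun t : ℝ => g (x + t • v) - t * y v) (gradient hg x v - 1 * y v) 0 :=
    (gradient_hasLineDerivAt hg x v).sub ((hasDerivAt_id (0 : ℝ)).mul_const (y v))
  have hmin : IsLocalMin (fun t : ℝ => g (x + t • v) - t * y v) 0 := by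
    refine Eventually.of_forall fun t => ?_
    have := hy (x + t • v)
    simp at this ⊢
    linarith
  linarith [hmin.hasDerivAt_eq_zero hd]

theorem coe_le_conj (g : X → ℝ) (x : X) (y : WeakDual ℝ X) :
    ((y x - g x : ℝ) : EReal) ≤ conj g y :=
  le_iSup (fun x : X => ((y x - g x : ℝ) : EReal)) x

theorem conj_ne_bot (g : X → ℝ) (y : WeakDual ℝ X) : conj g y ≠ ⊥ :=
  ne_bot_of_le_ne_bot (EReal.coe_ne_bot _) (coe_le_conj g 0 y)

theorem coe_toReal_conj {y : WeakDual ℝ X} (h : conj g y ≠ ⊤) :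
    ((conj g y).toReal : EReal) = conj g y :=
  EReal.coe_toReal h (conj_ne_bot g y)

theorem sub_le_toReal_conj {y : WeakDual ℝ X} (h : conj g y ≠ ⊤) (x : X) :
    y x - g x ≤ (conj g y).toReal := by
  rw [← EReal.coe_le_coe_iff, coe_toReal_conj h]
  exact coe_le_conj g x y

/-- Equality in the Young-Fenchel inequality at the gradient. -/
theorem conj_gradient (hg : GateauxDifferentiable g) (hc : ConvexOn ℝ univ g) (x : X) :
    conj g (gradient hg x) = ((gradient hg x x - g x : ℝ) : EReal) := by
  refine le_antisymm (iSup_le fun z => ?_) (coe_le_conj g x _)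
  have := gradient_subgradient hg hc x z
  rw [map_sub] at this
  exact_mod_cast (by linarith : gradient hg x z - g z ≤ gradient hg x x - g x)

theorem apply_le_opNorm (y : WeakDual ℝ X) (x : X) : y x ≤ opNorm y * ‖x‖ :=
  (le_abs_self _).trans ((WeakDual.toStrongDual y).le_opNorm x)

theorem opNorm_nonneg (y : WeakDual ℝ X) : 0 ≤ opNorm y := norm_nonneg _

theorem MinimalLinearGrowth.exists_lt {c : ℝ} (h : MinimalLinearGrowth g c) (a : ℝ) :
    ∃ R : ℝ, ∀ y : WeakDual ℝ X, R < opNorm y →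
      ((c * opNorm y : ℝ) : EReal) - conj g y < (a : EReal) := by
  obtain ⟨R, hR⟩ := (h.eventually_lt_const (EReal.bot_lt_coe a)).exists
  exact ⟨R, fun y hy => (le_iSup₂_of_le y hy le_rfl).trans_lt hR⟩

/-- Minimal linear growth of `g*` bounds the gradients of `g` uniformly on the ball of the
corresponding radius: there `g*(∇g x) ≤ c ‖∇g x‖ - g x`, and `g` is bounded below. -/
theorem exists_opNorm_gradient_le (hg : GateauxDifferentiable g) (hc : ConvexOn ℝ univ g) {c : ℝ}
    (h : MinimalLinearGrowth g c) :
    ∃ R : ℝ, ∀ x : X, ‖x‖ ≤ c → opNorm (gradient hg x) ≤ R := by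
  obtain ⟨R, hR⟩ := h.exists_lt (g 0 - opNorm (gradient hg 0) * c)
  refine ⟨R, fun x hx => ?_⟩
  by_contra! hlt
  have h1 := hR _ hlt
  rw [conj_gradient hg hc, ← EReal.coe_sub, EReal.coe_lt_coe_iff] at h1
  have h2 := gradient_subgradient hg hc 0 x
  have h3 := apply_le_opNorm (gradient hg 0) (-x)
  have h4 := apply_le_opNorm (gradient hg x) x
  have h5 := mul_le_mul_of_nonneg_left hx (opNorm_nonneg (gradient hg 0))
  have h6 := mul_le_mul_of_nonneg_left hx (opNorm_nonneg (gradient hg x))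
  rw [norm_neg, map_neg] at h3
  rw [sub_zero] at h2
  linarith

/-- On the ball of radius `c` the uniformly bounded gradients make `g` Lipschitz. -/
theorem continuousOn_of_minimalLinearGrowth (hg : GateauxDifferentiable g)
    (hc : ConvexOn ℝ univ g) {c : ℝ} (h : MinimalLinearGrowth g c) :
    ContinuousOn g (Metric.closedBall 0 c) := by
  obtain ⟨R, hR⟩ := exists_opNorm_gradient_le hg hc h
  have key : LipschitzOnWith (Real.toNNReal R) g (Metric.closedBall 0 c) := by
    refine LipschitzOnWith.of_le_add_mul' R fun x hx z _ => ?_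
    rw [mem_closedBall_zero_iff] at hx
    have h1 := gradient_subgradient hg hc x z
    have h2 := apply_le_opNorm (gradient hg x) (x - z)
    have h3 := mul_le_mul_of_nonneg_right (hR x hx) (norm_nonneg (x - z))
    rw [← neg_sub x z, map_neg] at h1
    rw [dist_eq_norm]
    linarith
  exact key.continuousOn

/-- The gradient is norm-to-weak* continuous on the ball whose radius is the minimal linear growth
of `g*`: the gradients stay in a weak* compact set, and every cluster point of gradients is a
subgradient at the limit point, hence the gradient there. -/
theorem continuousOn_gradient (hg : GateauxDifferentiable g) (hc : ConvexOn ℝ univ g) {c : ℝ}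
    (h : MinimalLinearGrowth g c) : ContinuousOn (gradient hg) (Metric.closedBall 0 c) := by
  obtain ⟨R, hR⟩ := exists_opNorm_gradient_le hg hc h
  intro x hx
  refine (WeakDual.isCompact_closedBall (𝕜 := ℝ) (0 : StrongDual ℝ X)
    R).tendsto_nhds_of_unique_mapClusterPt ?_ fun y _ hy => ?_
  · filter_upwards [self_mem_nhdsWithin] with x' hx'
    simpa [opNorm] using hR x' (by simpa using hx')
  obtain ⟨U, hU, hUy⟩ := mapClusterPt_iff_ultrafilter.1 hy
  refine eq_gradient_of_subgradient hg fun z => ?_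
  have hgU : Tendsto g U (𝓝 (g x)) := (continuousOn_of_minimalLinearGrowth hg hc h x hx).mono_left hU
  have hxU : Tendsto (fun x' : X => x') U (𝓝 x) := hU.trans nhdsWithin_le_nhds
  have hev : Tendsto (fun x' => gradient hg x' (z - x)) U (𝓝 (y (z - x))) :=
    ((WeakDual.eval_continuous (z - x)).tendsto y).comp hUy
  have hnorm : Tendsto (fun x' : X => R * ‖x' - x‖) U (𝓝 0) := by
    simpa using ((hxU.sub_const x).norm).const_mul R
  have hlim : Tendsto (fun x' => g x' + gradient hg x' (z - x) - R * ‖x' - x‖) U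
      (𝓝 (g x + y (z - x) - 0)) := (hgU.add hev).sub hnorm
  rw [sub_zero] at hlim
  refine le_of_tendsto hlim ?_
  filter_upwards [hU self_mem_nhdsWithin] with x' hx'
  have h1 := gradient_subgradient hg hc x' z
  have h2 := apply_le_opNorm (gradient hg x') (x' - x)
  have h3 := mul_le_mul_of_nonneg_right (hR x' (by simpa using hx')) (norm_nonneg (x' - x))
  have h4 : gradient hg x' (z - x) = gradient hg x' (z - x') + gradient hg x' (x' - x) := by
    rw [← map_add]; congr 1; abel
  linarith

/-- A weak* continuous `g*` is bounded on a weak* neighbourhood of `0`, which contains a subspace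
of finite codimension; coercivity forces that subspace to vanish. -/
theorem finiteDimensional_of_continuous_conj {c : ℝ} (hc : 0 ≤ c) (h : MinimalLinearGrowth g c)
    (hfin : ∀ y : WeakDual ℝ X, conj g y ≠ ⊤)
    (hcont : Continuous fun y : WeakDual ℝ X => (conj g y).toReal) :
    FiniteDimensional ℝ (WeakDual ℝ X) := by
  set a := (conj g (0 : WeakDual ℝ X)).toReal + 1 with ha
  have hnhds : {y : WeakDual ℝ X | (conj g y).toReal < a} ∈ 𝓝 (0 : WeakDual ℝ X) :=
    hcont.continuousAt.eventually_lt_const (by simp [ha])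
  obtain ⟨s, r, hr, hs⟩ := ((WeakDual.withSeminorms (𝕜 := ℝ) (E := X)).mem_nhds_iff _ _).1 hnhds
  obtain ⟨R, hR⟩ := h.exists_lt (-a)
  let T : WeakDual ℝ X →ₗ[ℝ] (s → ℝ) :=
    { toFun := fun y x => y x
      map_add' := fun _ _ => rfl
      map_smul' := fun _ _ => rfl }
  refine Module.Finite.of_injective T ((injective_iff_map_eq_zero T).2 fun y hy => ?_)
  by_contra hne
  have hpos : 0 < opNorm y := by
    refine norm_pos_iff.2 fun h0 => hne ?_
    simpa using h0
  -- the line through `y` lies in the neighbourhood and leaves every norm ball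
  obtain ⟨t, ht⟩ : ∃ t : ℝ, R < opNorm (t • y) := by
    refine ⟨(|R| + 1) / opNorm y, ?_⟩
    have : opNorm (((|R| + 1) / opNorm y) • y) = |R| + 1 := by
      have h1 : opNorm (((|R| + 1) / opNorm y) • y) = ‖(|R| + 1) / opNorm y‖ * opNorm y := by
        simp only [opNorm, map_smul, norm_smul]
      rw [h1, Real.norm_of_nonneg (by positivity), div_mul_cancel₀ _ hpos.ne']
    rw [this]
    linarith [le_abs_self R]
  have hmem : t • y ∈ (s.sup (WeakDual.seminormFamily ℝ X)).ball 0 r := by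
    rw [Seminorm.mem_ball_zero]
    refine Seminorm.finset_sup_apply_lt hr fun x hx => ?_
    have h0 : y x = 0 := congrFun hy ⟨x, hx⟩
    have h1 : (t • y) x = t * y x := rfl
    rw [WeakDual.seminormFamily_apply, h1, h0]
    simpa using hr
  have h1 : (conj g (t • y)).toReal < a := hs hmem
  have h2 := hR _ ht
  rw [← coe_toReal_conj (hfin _), ← EReal.coe_sub, EReal.coe_lt_coe_iff] at h2
  have h3 := mul_nonneg hc (opNorm_nonneg (t • y))
  linarith

/-- On a finite-dimensional dual space the weak* topology is the norm topology. -/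
theorem NormContinuous.continuous [FiniteDimensional ℝ (WeakDual ℝ X)] {Y : Type*}
    [TopologicalSpace Y] {P : WeakDual ℝ X → Y} (hP : NormContinuous P) : Continuous P := by
  have h : Continuous fun y : WeakDual ℝ X => WeakDual.toStrongDual y :=
    (WeakDual.toStrongDual (𝕜 := ℝ) (E := X)).toLinearMap.continuous_of_finiteDimensional
  exact Continuous.comp (g := fun y : StrongDual ℝ X => P (StrongDual.toWeakDual y)) hP h

end Gradient

/-! ### Equilibrium states are maximizers -/

theorem supNorm_nonneg {E X : Type*} [NormedAddCommGroup X] (K : Set E) (τ : E → X) :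
    0 ≤ supNorm K τ :=
  Real.sSup_nonneg (by rintro _ ⟨μ, _, rfl⟩; exact norm_nonneg _)

theorem mapsTo_closedBall_supNorm {E X : Type*} [TopologicalSpace E] [NormedAddCommGroup X]
    {K : Set E} (hK : IsCompact K) {τ : E → X} (hτ : ContinuousOn τ K) :
    MapsTo τ K (Metric.closedBall 0 (supNorm K τ)) := fun μ hμ =>
  mem_closedBall_zero_iff.2 (le_csSup (hK.image_of_continuousOn hτ.norm).bddAbove ⟨μ, hμ, rfl⟩)

theorem continuousOn_gradient_comp {E X : Type*} [TopologicalSpace E]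
    [NormedAddCommGroup X] [NormedSpace ℝ X] {K : Set E} (hK : IsCompact K) {τ : E → X}
    (hτ : ContinuousOn τ K) {g : X → ℝ} (hg : GateauxDifferentiable g)
    (hc : ConvexOn ℝ univ g) (h : MinimalLinearGrowth g (supNorm K τ)) :
    ContinuousOn (fun ν => gradient hg (τ ν)) K :=
  (continuousOn_gradient hg hc h).comp hτ (mapsTo_closedBall_supNorm hK hτ)

theorem nonlinearF_le_nonlinearPressure {E Xp Xm : Type*} {K : Set E} {f : E → EReal}
    {τp : E → Xp} {τm : E → Xm} {gp : Xp → ℝ} {gm : Xm → ℝ} {μ : E} (hμ : μ ∈ K) :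
    nonlinearF f τp τm gp gm μ ≤ nonlinearPressure K f τp τm gp gm :=
  le_iSup₂ (f := fun μ _ => nonlinearF f τp τm gp gm μ) μ hμ

section Equilibrium

variable {E : Type*} [AddCommGroup E] [Module ℝ E] [TopologicalSpace E]
variable {Xp : Type*} [NormedAddCommGroup Xp] [NormedSpace ℝ Xp]
variable {Xm : Type*} [NormedAddCommGroup Xm] [NormedSpace ℝ Xm]
variable {K : Set E} {f : E → EReal} {τp : E → Xp} {τm : E → Xm} {gp : Xp → ℝ} {gm : Xm → ℝ}

/-- The functions `g₊ ∘ τ₊` and `g₋ ∘ τ₋` are continuous on `K`, so `F` inherits upper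
semicontinuity from `f`. -/
theorem upperSemicontinuousOn_nonlinearF (hB1 : ConditionB1 K f τp τm)
    (hB2 : ConditionB2 K τm gm) (hB3 : ConditionB3 K τp gp)
    (hgp : GateauxDifferentiable gp) (hgm : GateauxDifferentiable gm) :
    UpperSemicontinuousOn (nonlinearF f τp τm gp gm) K := by
  have hp : ContinuousOn (fun μ => gp (τp μ)) K :=
    (continuousOn_of_minimalLinearGrowth hgp hB3.convex hB3.growth).comp hB1.continuousOn_τp
      (mapsTo_closedBall_supNorm hB1.isCompact hB1.continuousOn_τp)
  have hm : ContinuousOn (fun μ => gm (τm μ)) K :=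
    (continuousOn_of_minimalLinearGrowth hgm hB2.convex hB2.growth).comp hB1.continuousOn_τm
      (mapsTo_closedBall_supNorm hB1.isCompact hB1.continuousOn_τm)
  have hcont : ContinuousOn (fun μ => ((gp (τp μ) - gm (τm μ) : ℝ) : EReal)) K :=
    continuous_coe_real_ereal.comp_continuousOn (hp.sub hm)
  exact hB1.upperSemicontinuousOn.add' hcont.upperSemicontinuousOn fun μ _ =>
    EReal.continuousAt_add (Or.inr (EReal.coe_ne_bot _)) (Or.inr (EReal.coe_ne_top _))

theorem exists_nonlinearPressure_eq_coe (hB1 : ConditionB1 K f τp τm)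
    (hB2 : ConditionB2 K τm gm) (hB3 : ConditionB3 K τp gp)
    (hgp : GateauxDifferentiable gp) (hgm : GateauxDifferentiable gm) :
    ∃ p : ℝ, nonlinearPressure K f τp τm gp gm = (p : EReal) := by
  obtain ⟨μ, hμ, hbot⟩ := hB1.exists_ne_bot
  obtain ⟨ν, hν, hmax⟩ := (upperSemicontinuousOn_nonlinearF hB1 hB2 hB3 hgp hgm).exists_isMaxOn
    ⟨μ, hμ⟩ hB1.isCompact
  have heq : nonlinearPressure K f τp τm gp gm = nonlinearF f τp τm gp gm ν :=
    le_antisymm (iSup₂_le fun μ hμ => hmax hμ) (nonlinearF_le_nonlinearPressure hν)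
  have htop : nonlinearPressure K f τp τm gp gm ≠ ⊤ := by
    rw [heq, nonlinearF]
    exact EReal.add_ne_top (hB1.ne_top ν hν) (EReal.coe_ne_top _)
  have hbot' : nonlinearPressure K f τp τm gp gm ≠ ⊥ := by
    refine ne_bot_of_le_ne_bot ?_ (nonlinearF_le_nonlinearPressure hμ)
    rw [nonlinearF, Ne, EReal.add_eq_bot_iff, not_or]
    exact ⟨hbot, EReal.coe_ne_bot _⟩
  exact ⟨_, (EReal.coe_toReal htop hbot').symm⟩

/-- By upper semicontinuity, limits of maximizing nets are maximizers. -/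
theorem equilibriumStates_eq (hB1 : ConditionB1 K f τp τm)
    (hB2 : ConditionB2 K τm gm) (hB3 : ConditionB3 K τp gp)
    (hgp : GateauxDifferentiable gp) (hgm : GateauxDifferentiable gm) :
    equilibriumStates K f τp τm gp gm =
      K ∩ nonlinearF f τp τm gp gm ⁻¹' Ici (nonlinearPressure K f τp τm gp gm) := by
  ext μ
  refine ⟨fun ⟨hμ, l, hl, hlK, hlμ, hF⟩ => ⟨hμ, ?_⟩, fun ⟨hμ, hF⟩ => ⟨hμ, pure μ, ?_⟩⟩
  · change nonlinearPressure K f τp τm gp gm ≤ nonlinearF f τp τm gp gm μ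
    refine le_of_not_gt fun hlt => ?_
    obtain ⟨d, hd1, hd2⟩ := exists_between hlt
    have hub : ∀ᶠ ν in l, nonlinearF f τp τm gp gm ν < d :=
      (le_inf hlμ hlK) (upperSemicontinuousOn_nonlinearF hB1 hB2 hB3 hgp hgm μ hμ d hd1)
    exact (le_of_tendsto hF (hub.mono fun _ h => h.le)).not_gt hd2
  · have heq : nonlinearF f τp τm gp gm μ = nonlinearPressure K f τp τm gp gm :=
      le_antisymm (nonlinearF_le_nonlinearPressure hμ) hF
    refine ⟨inferInstance, by simpa using hμ, pure_le_nhds μ, ?_⟩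
    rw [← heq]
    exact tendsto_pure_nhds _ _

theorem isCompact_equilibriumStates (hB1 : ConditionB1 K f τp τm)
    (hB2 : ConditionB2 K τm gm) (hB3 : ConditionB3 K τp gp)
    (hgp : GateauxDifferentiable gp) (hgm : GateauxDifferentiable gm) :
    IsCompact (equilibriumStates K f τp τm gp gm) := by
  rw [equilibriumStates_eq hB1 hB2 hB3 hgp hgm]
  exact (upperSemicontinuousOn_nonlinearF hB1 hB2 hB3 hgp hgm).isCompact_inter_preimage_Ici
    hB1.isCompact _

theorem nonlinearF_eq_of_mem_equilibriumStates (hB1 : ConditionB1 K f τp τm)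
    (hB2 : ConditionB2 K τm gm) (hB3 : ConditionB3 K τp gp)
    (hgp : GateauxDifferentiable gp) (hgm : GateauxDifferentiable gm) {ν : E}
    (hν : ν ∈ equilibriumStates K f τp τm gp gm) :
    nonlinearF f τp τm gp gm ν = nonlinearPressure K f τp τm gp gm := by
  have h := hν
  rw [equilibriumStates_eq hB1 hB2 hB3 hgp hgm] at h
  exact le_antisymm (nonlinearF_le_nonlinearPressure h.1) h.2

/-! ### The approximating pressure at the gradients of an equilibrium state -/

/-- First-order optimality: a maximizer `ν` of `F` also maximizes the functional obtained by
replacing `g₊` and `g₋` by their linearizations at `τ₊ ν` and `τ₋ ν`. -/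
theorem linearized_le_of_isMaxOn (hB1 : ConditionB1 K f τp τm)
    (hgp : GateauxDifferentiable gp) (hgm : GateauxDifferentiable gm) {ν : E} (hν : ν ∈ K)
    (hmax : IsMaxOn (nonlinearF f τp τm gp gm) K ν) {a : ℝ} (ha : f ν = a)
    {μ : E} (hμ : μ ∈ K) :
    f μ + ((gradient hgp (τp ν) (τp μ) - gradient hgm (τm ν) (τm μ) : ℝ) : EReal) ≤
      ((a + (gradient hgp (τp ν) (τp ν) - gradient hgm (τm ν) (τm ν)) : ℝ) : EReal) := by
  induction hb : f μ with
  | bot => simp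
  | top => exact absurd hb (hB1.ne_top μ hμ)
  | coe b =>
  rw [← EReal.coe_add, EReal.coe_le_coe_iff]
  -- By concavity of `f`, `φ t + a` is at most the value of `F` at `(1 - t) ν + t μ`.
  set φ : ℝ → ℝ := fun t => t * (b - a) + (gp (τp ν + t • (τp μ - τp ν)) -
    gm (τm ν + t • (τm μ - τm ν))) with hφ
  have hd : HasDerivAt φ (1 * (b - a) + (gradient hgp (τp ν) (τp μ - τp ν) -
      gradient hgm (τm ν) (τm μ - τm ν))) 0 :=
    ((hasDerivAt_id (0 : ℝ)).mul_const (b - a)).add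
      ((gradient_hasLineDerivAt hgp _ _).sub (gradient_hasLineDerivAt hgm _ _))
  have hle : ∀ t ∈ Ioc (0 : ℝ) 1, φ t ≤ φ 0 := by
    intro t ht
    have ht0 : 0 ≤ 1 - t := by linarith [ht.2]
    have hsum : 1 - t + t = 1 := by ring
    have hconc := hB1.concave ν hν μ hμ (1 - t) t ht0 ht.1.le hsum
    have hF : nonlinearF f τp τm gp gm ((1 - t) • ν + t • μ) ≤ nonlinearF f τp τm gp gm ν :=
      hmax (hB1.convex hν hμ ht0 ht.1.le hsum)
    rw [nonlinearF, nonlinearF] at hF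
    rw [hB1.affine_τp ν hν μ hμ _ _ ht0 ht.1.le hsum,
      hB1.affine_τm ν hν μ hμ _ _ ht0 ht.1.le hsum,
      Convex.combo_eq_smul_sub_add (x := τp ν) hsum, Convex.combo_eq_smul_sub_add (x := τm ν) hsum,
      add_comm _ (τp ν), add_comm _ (τm ν), ha] at hF
    rw [ha, hb] at hconc
    have h := (add_le_add_left hconc _).trans hF
    norm_cast at h
    simp only [hφ, zero_mul, zero_smul, add_zero, zero_add]
    linarith
  have hslope : Tendsto (slope φ 0) (𝓝[>] 0) (𝓝 (1 * (b - a) +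
      (gradient hgp (τp ν) (τp μ - τp ν) - gradient hgm (τm ν) (τm μ - τm ν)))) :=
    hd.tendsto_slope.mono_left (nhdsWithin_mono _ fun t (ht : 0 < t) => ht.ne')
  have hnonpos := le_of_tendsto hslope (b := 0) <| by
    filter_upwards [Ioc_mem_nhdsGT (zero_lt_one (α := ℝ))] with t ht
    rw [slope_def_field]
    exact div_nonpos_of_nonpos_of_nonneg (sub_nonpos.2 (hle t ht)) (by linarith [ht.1])
  rw [map_sub, map_sub] at hnonpos
  linarith

theorem exists_coe_of_mem_equilibriumStates (hB1 : ConditionB1 K f τp τm)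
    (hB2 : ConditionB2 K τm gm) (hB3 : ConditionB3 K τp gp)
    (hgp : GateauxDifferentiable gp) (hgm : GateauxDifferentiable gm) {p : ℝ}
    (hp : nonlinearPressure K f τp τm gp gm = p) {ν : E}
    (hν : ν ∈ equilibriumStates K f τp τm gp gm) :
    ∃ a : ℝ, f ν = a ∧ p = a + (gp (τp ν) - gm (τm ν)) := by
  have h := nonlinearF_eq_of_mem_equilibriumStates hB1 hB2 hB3 hgp hgm hν
  rw [hp, nonlinearF] at h
  induction hf : f ν with
  | bot => simp [hf] at h
  | top => exact absurd hf (hB1.ne_top ν hν.1)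
  | coe a =>
    rw [hf] at h
    exact ⟨a, rfl, by exact_mod_cast h.symm⟩

/-- With `y± = ∇g±(τ± ν)`, the supremum in `P_L(y₊, y₋)` is attained at `ν`, and equality in the
Young-Fenchel inequalities turns `P_NL(y₊, y₋)` into `F ν`. -/
theorem PNL_gradient_le (hB1 : ConditionB1 K f τp τm)
    (hB2 : ConditionB2 K τm gm) (hB3 : ConditionB3 K τp gp)
    (hgp : GateauxDifferentiable gp) (hgm : GateauxDifferentiable gm) {p : ℝ}
    (hp : nonlinearPressure K f τp τm gp gm = p) {ν : E}
    (hν : ν ∈ equilibriumStates K f τp τm gp gm) :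
    PNL K f τp τm gp gm (gradient hgp (τp ν)) (gradient hgm (τm ν)) ≤ p := by
  obtain ⟨a, ha, hpa⟩ := exists_coe_of_mem_equilibriumStates hB1 hB2 hB3 hgp hgm hp hν
  have hmax : IsMaxOn (nonlinearF f τp τm gp gm) K ν := fun μ hμ =>
    (nonlinearF_le_nonlinearPressure hμ).trans_eq
      (nonlinearF_eq_of_mem_equilibriumStates hB1 hB2 hB3 hgp hgm hν).symm
  have hPL : PL K f τp τm (gradient hgp (τp ν)) (gradient hgm (τm ν)) ≤
      ((a + (gradient hgp (τp ν) (τp ν) - gradient hgm (τm ν) (τm ν)) : ℝ) : EReal) :=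
    iSup₂_le fun μ hμ => linearized_le_of_isMaxOn hB1 hgp hgm hν.1 hmax ha hμ
  rw [PNL, conj_gradient hgp hB3.convex, conj_gradient hgm hB2.convex]
  refine (EReal.sub_le_sub (add_le_add_left hPL _) le_rfl).trans ?_
  rw [← EReal.coe_add, ← EReal.coe_sub, EReal.coe_le_coe_iff]
  linarith

/-! ### A Kantorovich potential -/

/-- The pressure `sup_K { f - g₋ ∘ τ₋ + y₊ ∘ τ₊ }` in which only `g₊` is linearized. -/
def semilinearPressure {E Xp Xm : Type*} [NormedAddCommGroup Xp] [NormedSpace ℝ Xp]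
    (K : Set E) (f : E → EReal) (τp : E → Xp) (τm : E → Xm) (gm : Xm → ℝ)
    (yp : WeakDual ℝ Xp) : EReal :=
  ⨆ μ ∈ K, f μ + ((yp (τp μ) - gm (τm μ) : ℝ) : EReal)

/-- The function `sup_K { f - g₋ ∘ τ₋ + y₊ ∘ τ₊ } - g₊*(y₊)`; paired with the zero function it
solves the dual Kantorovich problem. -/
def potential {E Xp Xm : Type*} [NormedAddCommGroup Xp] [NormedSpace ℝ Xp]
    (K : Set E) (f : E → EReal) (τp : E → Xp) (τm : E → Xm) (gp : Xp → ℝ) (gm : Xm → ℝ)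
    (yp : WeakDual ℝ Xp) : ℝ :=
  (semilinearPressure K f τp τm gm yp).toReal - (conj gp yp).toReal

theorem semilinearPressure_le {E Xp Xm : Type*} [NormedAddCommGroup Xp] [NormedSpace ℝ Xp]
    {K : Set E} {f : E → EReal} {τp : E → Xp} {τm : E → Xm} {gp : Xp → ℝ} {gm : Xm → ℝ}
    (hfull : ∀ y : WeakDual ℝ Xp, conj gp y ≠ ⊤) {p : ℝ}
    (hp : nonlinearPressure K f τp τm gp gm = p) (y : WeakDual ℝ Xp) :
    semilinearPressure K f τp τm gm y ≤ ((p + (conj gp y).toReal : ℝ) : EReal) := by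
  refine iSup₂_le fun μ hμ => ?_
  have h1 := nonlinearF_le_nonlinearPressure (f := f) (τp := τp) (τm := τm) (gp := gp)
    (gm := gm) hμ
  have h2 := sub_le_toReal_conj (hfull y) (τp μ)
  rw [hp, nonlinearF] at h1
  induction hf : f μ with
  | bot => simp
  | top => rw [hf, EReal.top_add_coe] at h1; exact absurd h1 (EReal.coe_lt_top p).not_ge
  | coe b =>
    rw [hf] at h1
    norm_cast at h1 ⊢
    linarith

theorem coe_toReal_semilinearPressure (hB1 : ConditionB1 K f τp τm)
    (hfull : ∀ y : WeakDual ℝ Xp, conj gp y ≠ ⊤) {p : ℝ}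
    (hp : nonlinearPressure K f τp τm gp gm = p) (y : WeakDual ℝ Xp) :
    ((semilinearPressure K f τp τm gm y).toReal : EReal) = semilinearPressure K f τp τm gm y := by
  refine EReal.coe_toReal
    ((semilinearPressure_le hfull hp y).trans_lt (EReal.coe_lt_top _)).ne ?_
  obtain ⟨μ, hμ, hbot⟩ := hB1.exists_ne_bot
  refine ne_bot_of_le_ne_bot ?_ (le_iSup₂ (f := fun μ (_ : μ ∈ K) =>
    f μ + ((y (τp μ) - gm (τm μ) : ℝ) : EReal)) μ hμ)
  rw [Ne, EReal.add_eq_bot_iff, not_or]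
  exact ⟨hbot, EReal.coe_ne_bot _⟩

/-- The Young-Fenchel inequality `y₊(τ₊ μ) - g₊*(y₊) ≤ g₊(τ₊ μ)` bounds the potential by
`sup F(K)` everywhere. -/
theorem potential_le (hB1 : ConditionB1 K f τp τm)
    (hfull : ∀ y : WeakDual ℝ Xp, conj gp y ≠ ⊤) {p : ℝ}
    (hp : nonlinearPressure K f τp τm gp gm = p) (y : WeakDual ℝ Xp) :
    potential K f τp τm gp gm y ≤ p := by
  have h := semilinearPressure_le hfull hp y
  rw [← coe_toReal_semilinearPressure hB1 hfull hp y, EReal.coe_le_coe_iff] at h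
  rw [potential]
  linarith

/-- The bound is attained at the order parameter of an equilibrium state. -/
theorem potential_gradient_eq (hB1 : ConditionB1 K f τp τm)
    (hB2 : ConditionB2 K τm gm) (hB3 : ConditionB3 K τp gp)
    (hgp : GateauxDifferentiable gp) (hgm : GateauxDifferentiable gm) {p : ℝ}
    (hp : nonlinearPressure K f τp τm gp gm = p) {ν : E}
    (hν : ν ∈ equilibriumStates K f τp τm gp gm) :
    potential K f τp τm gp gm (gradient hgp (τp ν)) = p := by
  refine le_antisymm (potential_le hB1 hB3.full_domain hp _) ?_
  obtain ⟨a, ha, hpa⟩ := exists_coe_of_mem_equilibriumStates hB1 hB2 hB3 hgp hgm hp hν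
  have h := le_iSup₂ (f := fun μ (_ : μ ∈ K) =>
    f μ + ((gradient hgp (τp ν) (τp μ) - gm (τm μ) : ℝ) : EReal)) ν hν.1
  change _ ≤ semilinearPressure K f τp τm gm (gradient hgp (τp ν)) at h
  rw [← coe_toReal_semilinearPressure hB1 hB3.full_domain hp, ha, ← EReal.coe_add,
    EReal.coe_le_coe_iff] at h
  rw [potential, conj_gradient hgp hB3.convex, EReal.toReal_coe]
  linarith

/-- Feasibility follows from `-g₋(τ₋ μ) ≤ g₋*(y₋) - y₋(τ₋ μ)`. -/
theorem dualFeasible_potential (hB1 : ConditionB1 K f τp τm)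
    (hfull : ∀ y : WeakDual ℝ Xp, conj gp y ≠ ⊤) (hfin : ∀ y : WeakDual ℝ Xm, conj gm y ≠ ⊤)
    {p : ℝ} (hp : nonlinearPressure K f τp τm gp gm = p) :
    DualFeasible (PNL K f τp τm gp gm) (potential K f τp τm gp gm) fun _ => 0 := by
  intro yp ym
  have h : semilinearPressure K f τp τm gm yp ≤ PL K f τp τm yp ym + conj gm ym := by
    refine iSup₂_le fun μ hμ => ?_
    have h1 : f μ + ((yp (τp μ) - ym (τm μ) : ℝ) : EReal) ≤ PL K f τp τm yp ym :=
      le_iSup₂ (f := fun μ (_ : μ ∈ K) => f μ + ((yp (τp μ) - ym (τm μ) : ℝ) : EReal)) μ hμ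
    refine le_trans ?_ (add_le_add_left h1 _)
    rw [← coe_toReal_conj (hfin ym), add_assoc, ← EReal.coe_add]
    refine add_le_add_right (EReal.coe_le_coe_iff.2 ?_) _
    linarith [sub_le_toReal_conj (hfin ym) (τm μ)]
  rw [PNL, sub_zero, potential, EReal.coe_sub, coe_toReal_semilinearPressure hB1 hfull hp,
    coe_toReal_conj (hfull yp)]
  exact EReal.sub_le_sub h le_rfl

/-- A supremum of functions of `y₊` that are Lipschitz with constant `‖τ₊‖_∞`. -/
theorem normContinuous_semilinearPressure (hB1 : ConditionB1 K f τp τm)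
    (hfull : ∀ y : WeakDual ℝ Xp, conj gp y ≠ ⊤) {p : ℝ}
    (hp : nonlinearPressure K f τp τm gp gm = p) :
    NormContinuous fun y : WeakDual ℝ Xp => (semilinearPressure K f τp τm gm y).toReal := by
  refine (LipschitzWith.of_le_add_mul' (supNorm K τp) fun y z => ?_).continuous
  rw [← EReal.coe_le_coe_iff, coe_toReal_semilinearPressure hB1 hfull hp]
  refine iSup₂_le fun μ hμ => ?_
  have h1 := le_iSup₂ (f := fun μ (_ : μ ∈ K) =>
    f μ + ((z (τp μ) - gm (τm μ) : ℝ) : EReal)) μ hμ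
  change _ ≤ semilinearPressure K f τp τm gm (StrongDual.toWeakDual z) at h1
  rw [← coe_toReal_semilinearPressure hB1 hfull hp] at h1
  rw [EReal.coe_add]
  refine le_trans ?_ (add_le_add_left h1 _)
  rw [add_assoc, ← EReal.coe_add]
  refine add_le_add_right (EReal.coe_le_coe_iff.2 ?_) _
  have h2 : (y - z) (τp μ) ≤ ‖y - z‖ * ‖τp μ‖ := (le_abs_self _).trans ((y - z).le_opNorm _)
  have h3 : ‖τp μ‖ ≤ supNorm K τp := by
    simpa using mapsTo_closedBall_supNorm hB1.isCompact hB1.continuousOn_τp hμ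
  have h4 := mul_le_mul_of_nonneg_left h3 (norm_nonneg (y - z))
  rw [dist_eq_norm]
  rw [sub_apply] at h2
  rw [StrongDual.toWeakDual_apply]
  linarith

end Equilibrium

/-! ### Integration against the order-parameter distributions -/

section Integration

variable {E : Type*} [TopologicalSpace E] [T2Space E] [MeasurableSpace E] [BorelSpace E]
variable {X : Type*} [NormedAddCommGroup X] [NormedSpace ℝ X] {K : Set E} {m : Measure E}

theorem aemeasurable_gradient_comp (hK : IsCompact K) {τ : E → X} (hτ : ContinuousOn τ K)
    {g : X → ℝ} (hg : GateauxDifferentiable g) (hc : ConvexOn ℝ univ g)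
    (h : MinimalLinearGrowth g (supNorm K τ)) (hmK : ∀ᵐ ν ∂m, ν ∈ K) :
    AEMeasurable (fun ν => gradient hg (τ ν)) m := by
  rw [← Measure.restrict_eq_self_of_ae_mem hmK]
  exact (continuousOn_gradient_comp hK hτ hg hc h).aemeasurable hK.measurableSet

/-- An order-parameter distribution is carried by the image of any compact subset of `K` that
carries `m`; this image is weak* compact, hence Borel. -/
theorem orderParameterLaw_ae_mem_image (hK : IsCompact K) {τ : E → X} (hτ : ContinuousOn τ K)
    {g : X → ℝ} (hg : GateauxDifferentiable g) (hc : ConvexOn ℝ univ g)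
    (h : MinimalLinearGrowth g (supNorm K τ)) {S : Set E} (hS : IsCompact S) (hSK : S ⊆ K)
    (hmS : ∀ᵐ ν ∂m, ν ∈ S) :
    ∀ᵐ y ∂orderParameterLaw m τ hg, y ∈ (fun ν => gradient hg (τ ν)) '' S := by
  have himg : IsCompact ((fun ν => gradient hg (τ ν)) '' S) :=
    hS.image_of_continuousOn ((continuousOn_gradient_comp hK hτ hg hc h).mono hSK)
  refine (ae_map_iff (aemeasurable_gradient_comp hK hτ hg hc h (hmS.mono fun _ hν => hSK hν))
    himg.measurableSet).2 ?_
  filter_upwards [hmS] with ν hν using mem_image_of_mem _ hν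

theorem isProbabilityMeasure_orderParameterLaw [IsProbabilityMeasure m] (hK : IsCompact K)
    {τ : E → X} (hτ : ContinuousOn τ K) {g : X → ℝ} (hg : GateauxDifferentiable g)
    (hc : ConvexOn ℝ univ g) (h : MinimalLinearGrowth g (supNorm K τ))
    (hmK : ∀ᵐ ν ∂m, ν ∈ K) : IsProbabilityMeasure (orderParameterLaw m τ hg) :=
  Measure.isProbabilityMeasure_map (aemeasurable_gradient_comp hK hτ hg hc h hmK)

theorem integrable_orderParameterLaw_of_continuous [IsProbabilityMeasure m] (hK : IsCompact K)
    {τ : E → X} (hτ : ContinuousOn τ K) {g : X → ℝ} (hg : GateauxDifferentiable g)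
    (hc : ConvexOn ℝ univ g) (h : MinimalLinearGrowth g (supNorm K τ))
    (hmK : ∀ᵐ ν ∂m, ν ∈ K) {P : WeakDual ℝ X → ℝ} (hP : Continuous P) :
    Integrable P (orderParameterLaw m τ hg) := by
  have := isProbabilityMeasure_orderParameterLaw hK hτ hg hc h hmK
  obtain ⟨C, hC⟩ := (hK.image_of_continuousOn
    (continuousOn_gradient_comp hK hτ hg hc h)).exists_bound_of_continuousOn hP.continuousOn
  refine Integrable.of_bound hP.measurable.aestronglyMeasurable C ?_
  filter_upwards [orderParameterLaw_ae_mem_image hK hτ hg hc h hK Subset.rfl hmK] with y hy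
    using hC y hy

end Integration

/-! ### The dual Kantorovich problem -/

theorem Represents.ae_mem {E Xp Xm : Type*} [AddCommGroup E] [Module ℝ E] [TopologicalSpace E]
    [MeasurableSpace E] {K : Set E} {f : E → EReal} {τp : E → Xp} {τm : E → Xm} {gp : Xp → ℝ}
    {gm : Xm → ℝ} {m : Measure E} {μ : E} (hm : Represents K f τp τm gp gm m μ) :
    ∀ᵐ ν ∂m, ν ∈ equilibriumStates K f τp τm gp gm := hm.carried

section Duality

variable {E : Type*} [AddCommGroup E] [Module ℝ E] [TopologicalSpace E] [T2Space E]
  [MeasurableSpace E] [BorelSpace E]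
variable {Xp : Type*} [NormedAddCommGroup Xp] [NormedSpace ℝ Xp]
variable {Xm : Type*} [NormedAddCommGroup Xm] [NormedSpace ℝ Xm]
variable {K : Set E} {f : E → EReal} {τp : E → Xp} {τm : E → Xm} {gp : Xp → ℝ} {gm : Xm → ℝ}
  {m : Measure E} {μ : E}

/-- Weak duality: at an equilibrium state the constraint bounds the integrand by `sup F(K)`. -/
theorem integral_sub_integral_le (hB1 : ConditionB1 K f τp τm)
    (hB2 : ConditionB2 K τm gm) (hB3 : ConditionB3 K τp gp)
    (hgp : GateauxDifferentiable gp) (hgm : GateauxDifferentiable gm) {p : ℝ}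
    (hp : nonlinearPressure K f τp τm gp gm = p) (hm : Represents K f τp τm gp gm m μ)
    {Pp : WeakDual ℝ Xp → ℝ} {Pm : WeakDual ℝ Xm → ℝ}
    (hPp : Integrable Pp (orderParameterLaw m τp hgp))
    (hPm : Integrable Pm (orderParameterLaw m τm hgm))
    (hfeas : DualFeasible (PNL K f τp τm gp gm) Pp Pm) :
    (∫ y, Pp y ∂orderParameterLaw m τp hgp) - ∫ y, Pm y ∂orderParameterLaw m τm hgm ≤ p := by
  have := hm.isProbabilityMeasure
  have hmK : ∀ᵐ ν ∂m, ν ∈ K := hm.ae_mem.mono fun _ hν => hν.1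
  have hp' := aemeasurable_gradient_comp hB1.isCompact hB1.continuousOn_τp hgp hB3.convex
    hB3.growth hmK
  have hm' := aemeasurable_gradient_comp hB1.isCompact hB1.continuousOn_τm hgm hB2.convex
    hB2.growth hmK
  have ip : Integrable (fun ν => Pp (gradient hgp (τp ν))) m := hPp.comp_aemeasurable hp'
  have im : Integrable (fun ν => Pm (gradient hgm (τm ν))) m := hPm.comp_aemeasurable hm'
  have ep : ∫ y, Pp y ∂orderParameterLaw m τp hgp = ∫ ν, Pp (gradient hgp (τp ν)) ∂m :=
    integral_map hp' hPp.aestronglyMeasurable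
  have em : ∫ y, Pm y ∂orderParameterLaw m τm hgm = ∫ ν, Pm (gradient hgm (τm ν)) ∂m :=
    integral_map hm' hPm.aestronglyMeasurable
  rw [ep, em, ← integral_sub ip im]
  calc ∫ ν, (Pp (gradient hgp (τp ν)) - Pm (gradient hgm (τm ν))) ∂m
      ≤ ∫ _, p ∂m := by
        refine integral_mono_ae (ip.sub im) (integrable_const p) ?_
        filter_upwards [hm.ae_mem] with ν hν
        exact EReal.coe_le_coe_iff.1
          ((hfeas _ _).trans (PNL_gradient_le hB1 hB2 hB3 hgp hgm hp hν))
    _ = p := by simp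

/-- The set of equilibrium states is compact, so its image is a Borel set of full measure on which
the potential is constant; no measurability of the potential itself is needed. -/
theorem potential_ae_eq (hB1 : ConditionB1 K f τp τm)
    (hB2 : ConditionB2 K τm gm) (hB3 : ConditionB3 K τp gp)
    (hgp : GateauxDifferentiable gp) (hgm : GateauxDifferentiable gm) {p : ℝ}
    (hp : nonlinearPressure K f τp τm gp gm = p) (hm : Represents K f τp τm gp gm m μ) :
    potential K f τp τm gp gm =ᵐ[orderParameterLaw m τp hgp] fun _ => p := by
  filter_upwards [orderParameterLaw_ae_mem_image hB1.isCompact hB1.continuousOn_τp hgp hB3.convex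
    hB3.growth (isCompact_equilibriumStates hB1 hB2 hB3 hgp hgm) (fun _ hν => hν.1) hm.ae_mem]
    with y hy
  obtain ⟨ν, hν, rfl⟩ := hy
  exact potential_gradient_eq hB1 hB2 hB3 hgp hgm hp hν

theorem integrable_potential (hB1 : ConditionB1 K f τp τm)
    (hB2 : ConditionB2 K τm gm) (hB3 : ConditionB3 K τp gp)
    (hgp : GateauxDifferentiable gp) (hgm : GateauxDifferentiable gm) {p : ℝ}
    (hp : nonlinearPressure K f τp τm gp gm = p) (hm : Represents K f τp τm gp gm m μ) :
    Integrable (potential K f τp τm gp gm) (orderParameterLaw m τp hgp) := by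
  have := hm.isProbabilityMeasure
  have := isProbabilityMeasure_orderParameterLaw hB1.isCompact hB1.continuousOn_τp hgp hB3.convex
    hB3.growth (hm.ae_mem.mono fun _ hν => hν.1)
  exact (integrable_const p).congr (potential_ae_eq hB1 hB2 hB3 hgp hgm hp hm).symm

theorem integral_potential (hB1 : ConditionB1 K f τp τm)
    (hB2 : ConditionB2 K τm gm) (hB3 : ConditionB3 K τp gp)
    (hgp : GateauxDifferentiable gp) (hgm : GateauxDifferentiable gm) {p : ℝ}
    (hp : nonlinearPressure K f τp τm gp gm = p) (hm : Represents K f τp τm gp gm m μ) :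
    ∫ y, potential K f τp τm gp gm y ∂orderParameterLaw m τp hgp = p := by
  have := hm.isProbabilityMeasure
  have := isProbabilityMeasure_orderParameterLaw hB1.isCompact hB1.continuousOn_τp hgp hB3.convex
    hB3.growth (hm.ae_mem.mono fun _ hν => hν.1)
  rw [integral_congr_ae (potential_ae_eq hB1 hB2 hB3 hgp hgm hp hm)]
  simp

end Duality

end Bogoliubov

end

theorem mainTheorem6
    {E : Type*} [AddCommGroup E] [Module ℝ E] [TopologicalSpace E] [IsTopologicalAddGroup E]
    [ContinuousSMul ℝ E] [T2Space E] [MeasurableSpace E] [BorelSpace E]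
    {Xp : Type*} [NormedAddCommGroup Xp] [NormedSpace ℝ Xp] [TopologicalSpace.SeparableSpace Xp]
    {Xm : Type*} [NormedAddCommGroup Xm] [NormedSpace ℝ Xm] [TopologicalSpace.SeparableSpace Xm]
    (K : Set E) (f : E → EReal) (τp : E → Xp) (τm : E → Xm) (gp : Xp → ℝ) (gm : Xm → ℝ)
    (hB1 : Bogoliubov.ConditionB1 K f τp τm)
    (hB2 : Bogoliubov.ConditionB2 K τm gm)
    (hB3 : Bogoliubov.ConditionB3 K τp gp)
    (hgp : Bogoliubov.GateauxDifferentiable gp)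
    (hgm : Bogoliubov.GateauxDifferentiable gm)
    (hgm_finite : ∀ y : WeakDual ℝ Xm, Bogoliubov.conj gm y ≠ ⊤)
    (hgm_strict : StrictConvexOn ℝ univ fun y : WeakDual ℝ Xm => (Bogoliubov.conj gm y).toReal)
    (μ : E) (hμ : μ ∈ Bogoliubov.generalizedEquilibriumStates K f τp τm gp gm)
    (m : Measure E) (hm : Bogoliubov.Represents K f τp τm gp gm m μ) :
    ∃ p : ℝ, Bogoliubov.nonlinearPressure K f τp τm gp gm = (p : EReal) ∧
      ((Continuous fun y : WeakDual ℝ Xp => (Bogoliubov.conj gp y).toReal) →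
        (Continuous fun y : WeakDual ℝ Xm => (Bogoliubov.conj gm y).toReal) →
        IsLUB
          (Bogoliubov.weakStarDualValues (Bogoliubov.PNL K f τp τm gp gm)
            (Bogoliubov.orderParameterLaw m τp hgp) (Bogoliubov.orderParameterLaw m τm hgm)) p) ∧
      ((Bogoliubov.NormContinuous fun y : WeakDual ℝ Xp => (Bogoliubov.conj gp y).toReal) →
        (Bogoliubov.NormContinuous fun y : WeakDual ℝ Xm => (Bogoliubov.conj gm y).toReal) →
        IsLUB
          (Bogoliubov.normDualValues (Bogoliubov.PNL K f τp τm gp gm)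
            (Bogoliubov.orderParameterLaw m τp hgp) (Bogoliubov.orderParameterLaw m τm hgm)) p) := by
  obtain ⟨p, hp⟩ := Bogoliubov.exists_nonlinearPressure_eq_coe hB1 hB2 hB3 hgp hgm
  have hprob := hm.isProbabilityMeasure
  have hmK : ∀ᵐ ν ∂m, ν ∈ K := hm.ae_mem.mono fun _ hν => hν.1
  have hfeas := Bogoliubov.dualFeasible_potential hB1 hB3.full_domain hgm_finite hp
  have hval : p = (∫ y, Bogoliubov.potential K f τp τm gp gm y
        ∂Bogoliubov.orderParameterLaw m τp hgp) -
      ∫ _, (0 : ℝ) ∂Bogoliubov.orderParameterLaw m τm hgm := by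
    rw [Bogoliubov.integral_potential hB1 hB2 hB3 hgp hgm hp hm, integral_zero, sub_zero]
  have hsemi := Bogoliubov.normContinuous_semilinearPressure hB1 hB3.full_domain hp
  refine ⟨p, hp, fun hcp _ => IsGreatest.isLUB ⟨?_, ?_⟩, fun hcp _ => IsGreatest.isLUB ⟨?_, ?_⟩⟩
  -- weak* continuity of `g₊*` forces `X₊*` to be finite-dimensional
  · have := Bogoliubov.finiteDimensional_of_continuous_conj (Bogoliubov.supNorm_nonneg K τp)
      hB3.growth hB3.full_domain hcp
    exact ⟨_, fun _ => 0, hsemi.continuous.sub hcp, continuous_const, hfeas, hval⟩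
  · rintro _ ⟨Pp, Pm, hPp, hPm, hPfeas, rfl⟩
    exact Bogoliubov.integral_sub_integral_le hB1 hB2 hB3 hgp hgm hp hm
      (Bogoliubov.integrable_orderParameterLaw_of_continuous hB1.isCompact hB1.continuousOn_τp hgp
        hB3.convex hB3.growth hmK hPp)
      (Bogoliubov.integrable_orderParameterLaw_of_continuous hB1.isCompact hB1.continuousOn_τm hgm
        hB2.convex hB2.growth hmK hPm) hPfeas
  · exact ⟨_, fun _ => 0, Continuous.sub hsemi hcp, continuous_const,
      Bogoliubov.integrable_potential hB1 hB2 hB3 hgp hgm hp hm, integrable_zero _ _ _, hfeas,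
      hval⟩
  · rintro _ ⟨Pp, Pm, -, -, hPp, hPm, hPfeas, rfl⟩
    exact Bogoliubov.integral_sub_integral_le hB1 hB2 hB3 hgp hgm hp hm hPp hPm hPfeas
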